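/- Let $n\ge 1$ and $0<\alpha<2$, and let $(X_t)_{t\ge 0}$ be a rotationally symmetric $\alpha$-stable Lévy process on $\mathbb R^n$, normalized so that $$\mathbb E\,e^{i\xi\cdot X_t}=e^{-t|\xi|^\alpha},\qquad \xi\in\mathbb R^n,\ t\ge 0 .$$ Then for every $t>0$ and every $\kappa\in(-n,\alpha)$, $$\mathbb E|X_t|^\kappa=\frac{2^\kappa\,\Gamma\!\left(\frac{n+\kappa}{2}\right)\Gamma\!\left(1-\frac{\kappa}{\alpha}\right)}{\Gamma\!\left(\frac n2\right)\Gamma\!\left(1-\frac{\kappa}{2}\right)}\;t^{\kappa/\alpha},$$ and in particular this moment is finite. If $\kappa\in\mathbb R$ satisfies $\kappa\le -n$ or $\kappa\ge\alpha$, then $\mathbb E|X_t|^\kappa=\infty$ for every $t>0$. -/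

import Mathlib

open MeasureTheory ProbabilityTheory Topology
open scoped NNReal ENNReal

/-- A Lévy process on `E`, indexed by `t ∈ [0, ∞)`: it starts at `0`, it has independent and
stationary increments, and it is continuous in probability. -/
structure IsLevyProcess {Ω E : Type*} [MeasurableSpace Ω] [NormedAddCommGroup E]
    [MeasurableSpace E] (X : ℝ≥0 → Ω → E) (P : Measure Ω) : Prop where
  aemeasurable : ∀ t, AEMeasurable (X t) P
  start_zero : ∀ᵐ ω ∂P, X 0 ω = 0
  indep_increments : HasIndepIncrements X P
  stationary_increments :
    ∀ s t : ℝ≥0, IdentDistrib (fun ω ↦ X (s + t) ω - X s ω) (X t) P P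
  continuous_in_probability : ∀ t, TendstoInMeasure P X (𝓝 t) (X t)

/-- The rotationally symmetric `α`-stable Lévy process on `ℝⁿ`, in the normalization whose
generator is `-(-Δ)^(α/2)`: a Lévy process with `E exp(i ξ · X_t) = exp(-t |ξ|^α)`. -/
structure IsRotSymmStableLevyProcess {Ω : Type*} [MeasurableSpace Ω] {n : ℕ} (α : ℝ)
    (X : ℝ≥0 → Ω → EuclideanSpace ℝ (Fin n)) (P : Measure Ω) : Prop where
  isLevyProcess : IsLevyProcess X P
  charFun_eq : ∀ (t : ℝ≥0) (ξ : EuclideanSpace ℝ (Fin n)),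
    charFun (P.map (X t)) ξ = Complex.exp (-((t * ‖ξ‖ ^ α : ℝ) : ℂ))

/-! Let `Z` be a standard Gaussian vector. Integrating the kernel `exp(i⟨x, z⟩)` against the law of
`√(2s) X_t` and that of `Z`, in either order, gives `E exp(-s|X_t|²) = E exp(-t 2^(α/2) |Z|^α
s^(α/2))` (`integral_exp_neg_sq_eq`). A Mellin transform in `s` turns this into moments. The weight
`s^(p-1)` yields `E|X_t|^(-2p)` as a constant times `E|Z|^(-2p)`. Applied to `1 - exp`, the weight
`s^(-1-q)` yields `E|X_t|^(2q)`, for `0 < q < 1`, in terms of `E|Z|^(2q)`. Gaussian moments come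
from polar coordinates.

All identities are between integrals in `[0, ∞]`, so they also give divergence. For `κ ≤ -n` the
Gaussian moment is infinite. For `κ = α` the `s`-integral on the Gaussian side is infinite whenever
`Z ≠ 0`, and larger `κ` follow by comparison. -/

/-! ### Mellin integrals on the half-line, valued in `[0, ∞]` -/

theorem lintegral_Ioi_rpow_eq_top (a : ℝ) :
    ∫⁻ s in Set.Ioi (0 : ℝ), ENNReal.ofReal (s ^ a) = ⊤ := by
  by_contra h
  apply not_integrableOn_Ioi_rpow a
  refine ⟨by fun_prop, ?_⟩
  rw [hasFiniteIntegral_iff_ofReal]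
  · exact lt_top_iff_ne_top.2 h
  · filter_upwards [ae_restrict_mem measurableSet_Ioi] with s hs
    exact Real.rpow_nonneg (le_of_lt hs) _

theorem lintegral_Ioi_rpow_mul_exp {p β c : ℝ} (hp : 0 < p) (hβ : 0 < β) (hc : 0 < c) :
    ∫⁻ s in Set.Ioi (0 : ℝ), ENNReal.ofReal (s ^ (p - 1) * Real.exp (-(c * s ^ β))) =
      ENNReal.ofReal (c ^ (-p / β) * (1 / β) * Real.Gamma (p / β)) := by
  have h := integral_rpow_mul_exp_neg_mul_rpow (q := p - 1) hβ (by linarith) hc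
  have hG : 0 < Real.Gamma (p / β) := Real.Gamma_pos_of_pos (by positivity)
  simp only [sub_add_cancel, neg_mul] at h
  rw [← h, ofReal_integral_eq_lintegral_ofReal]
  -- A non-integrable function would have Bochner integral `0`, but the value is positive.
  · by_contra hn
    have := integral_undef hn
    rw [this] at h
    have : 0 < c ^ (-p / β) * (1 / β) * Real.Gamma (p / β) := by positivity
    exact this.ne h
  · filter_upwards [ae_restrict_mem measurableSet_Ioi] with s hs
    have : 0 < s := hs
    simp only [Pi.zero_apply]
    positivity

/-- The divergence is at the origin: on `(0, 1)` the exponential is at least `exp(-c)`, and `s ^ (p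
- 1)` is not integrable there. -/
theorem lintegral_Ioi_rpow_mul_exp_eq_top {p β c : ℝ} (hp : p ≤ 0) (hβ : 0 < β) (hc : 0 ≤ c) :
    ∫⁻ s in Set.Ioi (0 : ℝ), ENNReal.ofReal (s ^ (p - 1) * Real.exp (-(c * s ^ β))) = ⊤ := by
  have h1 : ∫⁻ s in Set.Ioo (0 : ℝ) 1, ENNReal.ofReal (s ^ (p - 1)) = ⊤ := by
    by_contra h
    have : IntegrableOn (fun s : ℝ ↦ s ^ (p - 1)) (Set.Ioo 0 1) := by
      refine ⟨by fun_prop, ?_⟩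
      rw [hasFiniteIntegral_iff_ofReal]
      · exact lt_top_iff_ne_top.2 h
      · filter_upwards [ae_restrict_mem measurableSet_Ioo] with s hs
        exact Real.rpow_nonneg hs.1.le _
    rw [intervalIntegral.integrableOn_Ioo_rpow_iff one_pos] at this
    linarith
  rw [eq_top_iff]
  calc (⊤ : ℝ≥0∞) = ENNReal.ofReal (Real.exp (-c)) *
        ∫⁻ s in Set.Ioo (0 : ℝ) 1, ENNReal.ofReal (s ^ (p - 1)) := by
        rw [h1, ENNReal.mul_top (by simp [Real.exp_pos])]
    _ = ∫⁻ s in Set.Ioo (0 : ℝ) 1,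
          ENNReal.ofReal (Real.exp (-c)) * ENNReal.ofReal (s ^ (p - 1)) := by
        rw [lintegral_const_mul' _ _ ENNReal.ofReal_ne_top]
    _ ≤ ∫⁻ s in Set.Ioo (0 : ℝ) 1,
          ENNReal.ofReal (s ^ (p - 1) * Real.exp (-(c * s ^ β))) := by
        refine setLIntegral_mono' measurableSet_Ioo fun s hs ↦ ?_
        rw [← ENNReal.ofReal_mul (Real.exp_pos _).le, mul_comm]
        refine ENNReal.ofReal_le_ofReal (mul_le_mul_of_nonneg_left ?_ (Real.rpow_nonneg hs.1.le _))
        refine Real.exp_le_exp.2 (neg_le_neg ?_)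
        exact mul_le_of_le_one_right hc (Real.rpow_le_one hs.1.le hs.2.le hβ.le)
    _ ≤ _ := lintegral_mono_set Set.Ioo_subset_Ioi_self

theorem lintegral_Ioo_deriv_one_sub_exp {β c s : ℝ} (hβ : 0 < β) (hc : 0 ≤ c) (hs : 0 < s) :
    ∫⁻ u in Set.Ioo 0 s,
        ENNReal.ofReal (c * β * (u ^ (β - 1) * Real.exp (-(c * u ^ β)))) =
      ENNReal.ofReal (1 - Real.exp (-(c * s ^ β))) := by
  have hcont : ContinuousOn (fun u : ℝ ↦ -Real.exp (-(c * u ^ β))) (Set.Icc 0 s) := by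
    have : Continuous fun u : ℝ ↦ u ^ β := Real.continuous_rpow_const hβ.le
    fun_prop
  have hderiv : ∀ u ∈ Set.Ioo 0 s, HasDerivAt (fun u : ℝ ↦ -Real.exp (-(c * u ^ β)))
      (c * β * (u ^ (β - 1) * Real.exp (-(c * u ^ β)))) u := by
    intro u hu
    convert! (((Real.hasDerivAt_rpow_const (p := β) (Or.inl hu.1.ne')).const_mul c).neg.exp).neg
      using 1
    simp only [Pi.neg_apply]
    ring
  have hnn : ∀ u ∈ Set.Ioo 0 s, 0 ≤ c * β * (u ^ (β - 1) * Real.exp (-(c * u ^ β))) := by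
    intro u hu
    have := hu.1
    positivity
  have hint := intervalIntegral.integrableOn_deriv_of_nonneg hcont hderiv hnn
  have h := intervalIntegral.integral_eq_sub_of_hasDerivAt_of_le hs.le hcont hderiv
    ((intervalIntegrable_iff_integrableOn_Ioc_of_le hs.le).2 hint)
  rw [intervalIntegral.integral_of_le hs.le, integral_Ioc_eq_integral_Ioo] at h
  rw [← ofReal_integral_eq_lintegral_ofReal (hint.mono_set Set.Ioo_subset_Ioc_self), h]
  · simp only [Real.zero_rpow hβ.ne', mul_zero, neg_zero, Real.exp_zero]
    ring_nf
  · filter_upwards [ae_restrict_mem measurableSet_Ioo] with u hu using hnn u hu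

theorem lintegral_Ioi_rpow_neg_one_sub {q u : ℝ} (hq : 0 < q) (hu : 0 < u) :
    ∫⁻ s in Set.Ioi u, ENNReal.ofReal (s ^ (-1 - q)) = ENNReal.ofReal (u ^ (-q) / q) := by
  rw [← ofReal_integral_eq_lintegral_ofReal (integrableOn_Ioi_rpow_of_lt (by linarith) hu),
    integral_Ioi_rpow_of_lt (by linarith) hu]
  · congr 1
    rw [show -1 - q + 1 = -q by ring, neg_div_neg_eq]
  · filter_upwards [ae_restrict_mem measurableSet_Ioi] with s hs
    exact Real.rpow_nonneg (hu.trans hs).le _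

/-- Integration by parts, done as Tonelli on `{0 < u < s}` after writing `1 - exp` as the integral
of its derivative. No boundary terms arise, so both sides may be infinite; this covers `β ≤ q` as
well. -/
theorem lintegral_Ioi_one_sub_exp_eq {q β c : ℝ} (hq : 0 < q) (hβ : 0 < β) (hc : 0 < c) :
    ∫⁻ s in Set.Ioi (0 : ℝ), ENNReal.ofReal ((1 - Real.exp (-(c * s ^ β))) * s ^ (-1 - q)) =
      ENNReal.ofReal (c * β / q) *
      ∫⁻ u in Set.Ioi (0 : ℝ), ENNReal.ofReal (u ^ (β - q - 1) * Real.exp (-(c * u ^ β))) := by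
  set g : ℝ → ℝ≥0∞ := fun u ↦ ENNReal.ofReal (c * β * (u ^ (β - 1) * Real.exp (-(c * u ^ β))))
    with hg
  have hgm : Measurable g := by fun_prop
  set h : ℝ → ℝ≥0∞ := fun s ↦ ENNReal.ofReal (s ^ (-1 - q)) with hh
  have hhm : Measurable h := by fun_prop
  calc _ = ∫⁻ s in Set.Ioi (0 : ℝ), ∫⁻ u in Set.Ioi (0 : ℝ),
        {x : ℝ × ℝ | x.2 < x.1}.indicator (fun x ↦ g x.2 * h x.1) (s, u) := by
        refine setLIntegral_congr_fun measurableSet_Ioi fun s (hs : 0 < s) ↦ ?_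
        have hexp : Real.exp (-(c * s ^ β)) ≤ 1 := Real.exp_le_one_iff.2 (by
          have : 0 ≤ c * s ^ β := by positivity
          linarith)
        rw [ENNReal.ofReal_mul (by linarith), ← lintegral_Ioo_deriv_one_sub_exp hβ hc.le hs,
          ← lintegral_mul_const _ hgm]
        rw [← lintegral_indicator measurableSet_Ioi, ← lintegral_indicator measurableSet_Ioo]
        congr 1 with u
        by_cases h0 : 0 < u <;> by_cases h1 : u < s <;> simp [h0, h1, hg, hh, Set.indicator]
    _ = ∫⁻ u in Set.Ioi (0 : ℝ), ∫⁻ s in Set.Ioi (0 : ℝ),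
        {x : ℝ × ℝ | x.2 < x.1}.indicator (fun x ↦ g x.2 * h x.1) (s, u) := by
        refine lintegral_lintegral_swap (Measurable.aemeasurable ?_)
        exact Measurable.indicator (by fun_prop) (measurableSet_lt measurable_snd measurable_fst)
    _ = ∫⁻ u in Set.Ioi (0 : ℝ), g u * ENNReal.ofReal (u ^ (-q) / q) := by
        refine setLIntegral_congr_fun measurableSet_Ioi fun u (hu : 0 < u) ↦ ?_
        rw [← lintegral_Ioi_rpow_neg_one_sub hq hu, ← lintegral_const_mul _ hhm,
          ← lintegral_indicator measurableSet_Ioi, ← lintegral_indicator measurableSet_Ioi]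
        congr 1 with s
        by_cases h1 : u < s
        · simp [h1, hu.trans h1]
        · simp [h1, Set.indicator]
    _ = _ := by
        rw [← lintegral_const_mul' _ _ ENNReal.ofReal_ne_top]
        refine setLIntegral_congr_fun measurableSet_Ioi fun u (hu : 0 < u) ↦ ?_
        simp only [hg]
        rw [← ENNReal.ofReal_mul (by positivity), ← ENNReal.ofReal_mul (by positivity)]
        congr 1
        rw [show β - q - 1 = (β - 1) + (-q) by ring, Real.rpow_add hu]
        field_simp

/-- Negative powers of `r` as a Mellin transform, in a form that holds at `r = 0` too. -/
theorem lintegral_Ioi_rpow_mul_exp_norm {p β a r : ℝ} (hp : 0 < p) (hβ : 0 < β) (ha : 0 < a)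
    (hr : 0 ≤ r) :
    ∫⁻ s in Set.Ioi (0 : ℝ),
        ENNReal.ofReal (s ^ (p - 1) * Real.exp (-(a * r ^ (2 * β) * s ^ β))) =
      ENNReal.ofReal (a ^ (-p / β) * (1 / β) * Real.Gamma (p / β)) *
        ENNReal.ofReal r ^ (-(2 * p)) := by
  have hG : 0 < Real.Gamma (p / β) := Real.Gamma_pos_of_pos (by positivity)
  rcases hr.eq_or_lt with rfl | hr
  · rw [Real.zero_rpow (by positivity)]
    simp only [mul_zero, zero_mul, neg_zero, Real.exp_zero, mul_one, ENNReal.ofReal_zero]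
    -- At `r = 0` both sides are infinite, since `0 ^ (-(2 * p)) = ⊤` in `ℝ≥0∞`.
    rw [lintegral_Ioi_rpow_eq_top, ENNReal.zero_rpow_of_neg (by linarith), ENNReal.mul_top]
    rw [ENNReal.ofReal_ne_zero_iff]
    positivity
  · rw [lintegral_Ioi_rpow_mul_exp hp hβ (by positivity), ENNReal.ofReal_rpow_of_pos hr,
      ← ENNReal.ofReal_mul (by positivity)]
    congr 1
    rw [Real.mul_rpow ha.le (by positivity), ← Real.rpow_mul hr.le,
      show 2 * β * (-p / β) = -(2 * p) by field_simp]
    ring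

theorem lintegral_Ioi_one_sub_exp_norm {q β a r : ℝ} (hq : 0 < q) (hβ : q < β) (ha : 0 < a)
    (hr : 0 ≤ r) :
    ∫⁻ s in Set.Ioi (0 : ℝ),
        ENNReal.ofReal ((1 - Real.exp (-(a * r ^ (2 * β) * s ^ β))) * s ^ (-1 - q)) =
      ENNReal.ofReal (a ^ (q / β) * Real.Gamma (1 - q / β) / q) *
        ENNReal.ofReal r ^ (2 * q) := by
  have hβ0 : 0 < β := hq.trans hβ
  rcases hr.eq_or_lt with rfl | hr
  · rw [Real.zero_rpow (by positivity)]
    simp [hq]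
  · rw [lintegral_Ioi_one_sub_exp_eq hq hβ0 (by positivity),
      lintegral_Ioi_rpow_mul_exp (by linarith) hβ0 (by positivity), ENNReal.ofReal_rpow_of_pos hr,
      ← ENNReal.ofReal_mul (by positivity), ← ENNReal.ofReal_mul]
    · congr 1
      have h1 : (a * r ^ (2 * β)) * (a * r ^ (2 * β)) ^ (-(β - q) / β) =
          a ^ (q / β) * r ^ (2 * q) := by
        rw [← Real.rpow_one_add' (by positivity) (by rw [show 1 + -(β - q) / β = q / β by field_simp; ring]; positivity),
          Real.mul_rpow ha.le (by positivity), ← Real.rpow_mul hr.le]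
        congr 2 <;> (field_simp; ring)
      rw [sub_div, div_self hβ0.ne']
      linear_combination (norm := (field_simp; ring)) (Real.Gamma (1 - q / β) / q) * h1
    · have : 0 < Real.Gamma (1 - q / β) :=
        Real.Gamma_pos_of_pos (by rw [sub_pos, div_lt_one hβ0]; exact hβ)
      positivity

theorem lintegral_Ioi_one_sub_exp_eq_top {q β c : ℝ} (hq : 0 < q) (hβ : 0 < β) (hqβ : β ≤ q)
    (hc : 0 < c) :
    ∫⁻ s in Set.Ioi (0 : ℝ),
      ENNReal.ofReal ((1 - Real.exp (-(c * s ^ β))) * s ^ (-1 - q)) = ⊤ := by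
  rw [lintegral_Ioi_one_sub_exp_eq hq hβ hc,
    lintegral_Ioi_rpow_mul_exp_eq_top (by linarith) hβ hc.le, ENNReal.mul_top]
  rw [ENNReal.ofReal_ne_zero_iff]
  positivity

/-! ### Gaussian measure and its moments -/

/-- Polar coordinates for the Lebesgue integral of a radial function. -/
theorem lintegral_fun_norm_addHaar {E : Type*} [NormedAddCommGroup E] [NormedSpace ℝ E]
    [Nontrivial E] [MeasurableSpace E] [BorelSpace E] [FiniteDimensional ℝ E] (μ : Measure E)
    [μ.IsAddHaarMeasure] {f : ℝ → ℝ≥0∞} (hf : Measurable f) :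
    ∫⁻ x, f ‖x‖ ∂μ = Module.finrank ℝ E * μ (Metric.ball 0 1) *
      ∫⁻ y in Set.Ioi (0 : ℝ), ENNReal.ofReal (y ^ (Module.finrank ℝ E - 1)) * f y :=
  calc
    ∫⁻ x, f ‖x‖ ∂μ = ∫⁻ x : ({(0)}ᶜ : Set E), f ‖x.1‖ ∂(μ.comap (↑)) := by
      rw [lintegral_subtype_comap (measurableSet_singleton _).compl fun x ↦ f ‖x‖,
        restrict_compl_singleton]
    _ = ∫⁻ x, f x.2 ∂μ.toSphere.prod (.volumeIoiPow (Module.finrank ℝ E - 1)) := by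
      simpa using μ.measurePreserving_homeomorphUnitSphereProd.lintegral_comp_emb
        (Homeomorph.measurableEmbedding _) (f ∘ Subtype.val ∘ Prod.snd)
    _ = μ.toSphere Set.univ *
          ∫⁻ x : Set.Ioi (0 : ℝ), f x ∂.volumeIoiPow (Module.finrank ℝ E - 1) := by
      rw [lintegral_prod _ (by fun_prop)]
      simp [mul_comm]
    _ = _ := by
      rw [μ.toSphere_apply_univ, Measure.volumeIoiPow,
        lintegral_withDensity_eq_lintegral_mul _ (by fun_prop) (by fun_prop)]
      simp only [Pi.mul_apply]
      rw [lintegral_subtype_comap measurableSet_Ioi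
        fun a ↦ ENNReal.ofReal (a ^ (Module.finrank ℝ E - 1)) * f a]

/-- The standard Gaussian measure on `ℝⁿ`, given by its density. -/
noncomputable def gaussianDensityMeasure (n : ℕ) : Measure (EuclideanSpace ℝ (Fin n)) :=
  volume.withDensity fun z ↦
    ENNReal.ofReal ((2 * Real.pi) ^ (-(n : ℝ) / 2) * Real.exp (-(1 / 2 * ‖z‖ ^ (2 : ℝ))))

theorem charFun_gaussianDensityMeasure (n : ℕ) (x : EuclideanSpace ℝ (Fin n)) :
    charFun (gaussianDensityMeasure n) x = Complex.exp (-(‖x‖ ^ 2 / 2)) := by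
  rw [charFun_apply, gaussianDensityMeasure, integral_withDensity_eq_integral_toReal_smul₀
    (by fun_prop) (by simp)]
  have h := GaussianFourier.integral_cexp_neg_mul_sq_norm_add (b := 1 / 2) (by norm_num)
    Complex.I x
  have hpi : (0 : ℝ) < 2 * Real.pi := by positivity
  calc _ = ∫ v : EuclideanSpace ℝ (Fin n), (((2 * Real.pi) ^ (-(n : ℝ) / 2) : ℝ) : ℂ) *
        Complex.exp (-(1 / 2) * ‖v‖ ^ 2 + Complex.I * inner ℝ x v) := by
        congr 1 with v
        rw [ENNReal.toReal_ofReal (by positivity), Complex.real_smul, Complex.exp_add,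
          Complex.ofReal_mul, Complex.ofReal_exp, real_inner_comm]
        simp only [Real.rpow_ofNat]
        push_cast
        rw [mul_assoc, mul_comm Complex.I, neg_mul]
    _ = _ := by
        rw [integral_const_mul, h, ← mul_assoc, finrank_euclideanSpace_fin]
        have h1 : (((2 * Real.pi) ^ (-(n : ℝ) / 2) : ℝ) : ℂ) *
            (Real.pi / (1 / 2)) ^ ((n : ℂ) / 2) = 1 := by
          rw [show (Real.pi / (1 / 2) : ℂ) = ((2 * Real.pi : ℝ) : ℂ) by push_cast; ring,
            show ((n : ℂ) / 2) = (((n : ℝ) / 2 : ℝ) : ℂ) by push_cast; ring,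
            ← Complex.ofReal_cpow hpi.le, ← Complex.ofReal_mul, ← Real.rpow_add hpi]
          ring_nf
          simp
        rw [h1, one_mul, Complex.I_sq]
        ring_nf

instance isProbabilityMeasure_gaussianDensityMeasure (n : ℕ) :
    IsProbabilityMeasure (gaussianDensityMeasure n) := by
  have hf : IsFiniteMeasure (gaussianDensityMeasure n) := by
    refine isFiniteMeasure_withDensity_ofReal (Integrable.hasFiniteIntegral ?_)
    refine Integrable.const_mul ?_ _
    have h := (GaussianFourier.integrable_cexp_neg_mul_sq_norm_add (b := 1 / 2) (by norm_num)
      0 (0 : EuclideanSpace ℝ (Fin n))).norm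
    refine h.congr (.of_forall fun v ↦ ?_)
    simp [Complex.norm_exp, ← Complex.ofReal_pow]
  -- The total mass is the characteristic function at `0`.
  have h := charFun_gaussianDensityMeasure n 0
  rw [charFun_zero] at h
  have h1 : (gaussianDensityMeasure n).real Set.univ = 1 := by
    simpa using h
  exact ⟨(ENNReal.toReal_eq_one_iff _).1 h1⟩

theorem lintegral_norm_rpow_gaussianDensityMeasure_aux {n : ℕ} (hn : 1 ≤ n) (κ : ℝ) :
    ∫⁻ z, ‖z‖ₑ ^ κ ∂gaussianDensityMeasure n =
      n * ENNReal.ofReal (√Real.pi ^ n / Real.Gamma (n / 2 + 1)) *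
        (ENNReal.ofReal ((2 * Real.pi) ^ (-(n : ℝ) / 2)) *
        ∫⁻ y in Set.Ioi (0 : ℝ),
          ENNReal.ofReal (y ^ ((n + κ) - 1) * Real.exp (-(1 / 2 * y ^ (2 : ℝ))))) := by
  have : NeZero n := ⟨by omega⟩
  have : Nontrivial (EuclideanSpace ℝ (Fin n)) :=
    Module.nontrivial_of_finrank_pos (R := ℝ) (by simpa using Nat.pos_of_ne_zero (by omega))
  rw [gaussianDensityMeasure, lintegral_withDensity_eq_lintegral_mul _ (by fun_prop) (by fun_prop)]
  simp only [Pi.mul_apply, ← ofReal_norm]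
  rw [lintegral_fun_norm_addHaar volume (f := fun r ↦ ENNReal.ofReal ((2 * Real.pi) ^ (-(n : ℝ) / 2)
    * Real.exp (-(1 / 2 * r ^ (2 : ℝ)))) * ENNReal.ofReal r ^ κ) (by fun_prop)]
  rw [EuclideanSpace.volume_ball, finrank_euclideanSpace_fin, Fintype.card_fin,
    ← lintegral_const_mul' _ _ ENNReal.ofReal_ne_top]
  simp only [ENNReal.ofReal_one, one_pow, one_mul]
  congr 1
  refine setLIntegral_congr_fun measurableSet_Ioi fun y (hy : 0 < y) ↦ ?_
  rw [ENNReal.ofReal_rpow_of_pos hy, ← ENNReal.ofReal_mul (by positivity),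
    ← ENNReal.ofReal_mul (by positivity), ← ENNReal.ofReal_mul (by positivity)]
  congr 1
  -- The Jacobian exponent `n - 1` is a natural subtraction; `hn` makes it agree with the real one.
  rw [show (n + κ - 1) = ((n - 1 : ℕ) : ℝ) + κ by push_cast [hn]; ring, Real.rpow_add hy,
    Real.rpow_natCast]
  ring

theorem lintegral_norm_rpow_gaussianDensityMeasure {n : ℕ} (hn : 1 ≤ n) {κ : ℝ}
    (hκ : -(n : ℝ) < κ) :
    ∫⁻ z, ‖z‖ₑ ^ κ ∂gaussianDensityMeasure n =
      ENNReal.ofReal (2 ^ (κ / 2) * Real.Gamma ((n + κ) / 2) / Real.Gamma (n / 2)) := by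
  have hn0 : (0 : ℝ) < n := by exact_mod_cast hn
  have hG : 0 < Real.Gamma (n / 2) := Real.Gamma_pos_of_pos (by positivity)
  have hG1 : 0 < Real.Gamma ((n + κ) / 2) := Real.Gamma_pos_of_pos (by linarith)
  rw [lintegral_norm_rpow_gaussianDensityMeasure_aux hn,
    lintegral_Ioi_rpow_mul_exp (by linarith) two_pos (by norm_num),
    Real.Gamma_add_one (by positivity), ← ENNReal.ofReal_natCast,
    ← ENNReal.ofReal_mul (by positivity), ← ENNReal.ofReal_mul (by positivity),
    ← ENNReal.ofReal_mul (by positivity)]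
  congr 1
  have h1 : √Real.pi ^ n = Real.pi ^ ((n : ℝ) / 2) := by
    rw [Real.sqrt_eq_rpow, ← Real.rpow_natCast, ← Real.rpow_mul Real.pi_pos.le]
    ring_nf
  have h2 : ((1 : ℝ) / 2) ^ (-(n + κ) / 2) = 2 ^ ((n : ℝ) / 2) * 2 ^ (κ / 2) := by
    rw [one_div, Real.inv_rpow two_pos.le, ← Real.rpow_neg two_pos.le, ← Real.rpow_add two_pos]
    ring_nf
  have h3 : (2 * Real.pi) ^ (-(n : ℝ) / 2) = (2 ^ ((n : ℝ) / 2) * Real.pi ^ ((n : ℝ) / 2))⁻¹ := by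
    rw [neg_div, Real.rpow_neg (by positivity), Real.mul_rpow two_pos.le Real.pi_pos.le]
  rw [h1, h2, h3]
  have : (2 : ℝ) ^ ((n : ℝ) / 2) ≠ 0 := by positivity
  have : Real.pi ^ ((n : ℝ) / 2) ≠ 0 := by positivity
  field_simp

theorem lintegral_norm_rpow_gaussianDensityMeasure_eq_top {n : ℕ} (hn : 1 ≤ n) {κ : ℝ}
    (hκ : κ ≤ -(n : ℝ)) :
    ∫⁻ z, ‖z‖ₑ ^ κ ∂gaussianDensityMeasure n = ⊤ := by
  have hn0 : (0 : ℝ) < n := by exact_mod_cast hn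
  have hG : 0 < Real.Gamma ((n : ℝ) / 2 + 1) := Real.Gamma_pos_of_pos (by positivity)
  rw [lintegral_norm_rpow_gaussianDensityMeasure_aux hn,
    lintegral_Ioi_rpow_mul_exp_eq_top (by linarith) two_pos (by norm_num), ENNReal.mul_top,
    ENNReal.mul_top]
  · refine mul_ne_zero (by simp; omega) ?_
    rw [ENNReal.ofReal_ne_zero_iff]
    positivity
  · rw [ENNReal.ofReal_ne_zero_iff]
    positivity

theorem ae_ne_zero_gaussianDensityMeasure {n : ℕ} (hn : 1 ≤ n) :
    ∀ᵐ z ∂gaussianDensityMeasure n, z ≠ 0 := by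
  have : Nontrivial (EuclideanSpace ℝ (Fin n)) :=
    Module.nontrivial_of_finrank_pos (R := ℝ) (by simpa using Nat.pos_of_ne_zero (by omega))
  refine (withDensity_absolutelyContinuous _ _).ae_le ?_
  exact (ae_iff.2 (by simp))

/-! ### Laplace transform of the squared norm -/

/-- Fubini for the symmetric kernel `exp(i⟨x, z⟩)`, which is bounded by 1 on a finite product
measure. -/
theorem integral_charFun_comm {E : Type*} [NormedAddCommGroup E] [InnerProductSpace ℝ E]
    [MeasurableSpace E] [BorelSpace E] [SecondCountableTopology E] (μ ν : Measure E)
    [IsFiniteMeasure μ] [IsFiniteMeasure ν] :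
    ∫ x, charFun ν x ∂μ = ∫ z, charFun μ z ∂ν := by
  simp only [charFun_apply]
  rw [integral_integral_swap]
  · simp only [real_inner_comm]
  · refine Integrable.of_bound (C := 1) (Continuous.aestronglyMeasurable ?_) (.of_forall ?_)
    · simp only [Function.uncurry_def]
      fun_prop
    · intro x
      simp [Function.uncurry, Complex.norm_exp_ofReal_mul_I]

section

variable {n : ℕ} {α t : ℝ} {μ : Measure (EuclideanSpace ℝ (Fin n))} [IsProbabilityMeasure μ]

theorem integrable_exp_neg_of_nonneg {E : Type*} [MeasurableSpace E] {μ : Measure E}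
    [IsFiniteMeasure μ] {f : E → ℝ} (hf : Measurable f) (hf0 : ∀ x, 0 ≤ f x) :
    Integrable (fun x ↦ Real.exp (-f x)) μ := by
  refine Integrable.of_bound (C := 1) (by fun_prop) (.of_forall fun x ↦ ?_)
  rw [Real.norm_eq_abs, Real.abs_exp, Real.exp_le_one_iff]
  linarith [hf0 x]

/-- The Laplace transform of `|x|²` under a rotationally symmetric stable law. -/
theorem integral_exp_neg_sq_eq
    (hμ : ∀ ξ, charFun μ ξ = Complex.exp (-((t * ‖ξ‖ ^ α : ℝ) : ℂ))) {s : ℝ} (hs : 0 < s) :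
    ∫ x, Real.exp (-(1 * ‖x‖ ^ (2 * (1 : ℝ)) * s ^ (1 : ℝ))) ∂μ =
      ∫ z, Real.exp (-(t * 2 ^ (α / 2) * ‖z‖ ^ (2 * (α / 2)) * s ^ (α / 2)))
        ∂gaussianDensityMeasure n := by
  have : IsProbabilityMeasure (μ.map fun x ↦ √(2 * s) • x) :=
    Measure.isProbabilityMeasure_map (by fun_prop)
  -- The scale `√(2 * s)` turns the Gaussian transform `exp(-|x|²/2)` into `exp(-s|x|²)`.
  have h := integral_charFun_comm (μ.map fun x ↦ √(2 * s) • x) (gaussianDensityMeasure n)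
  simp only [charFun_gaussianDensityMeasure, charFun_map_smul, hμ] at h
  rw [integral_map (by fun_prop) (by fun_prop)] at h
  rw [← Complex.ofReal_inj, ← integral_complex_ofReal, ← integral_complex_ofReal]
  convert! h using 3 with x z
  · push_cast
    congr 1
    rw [norm_smul, Real.norm_of_nonneg (Real.sqrt_nonneg _), Complex.ofReal_mul, mul_pow,
      ← Complex.ofReal_pow (√(2 * s)), Real.sq_sqrt (by positivity)]
    simp only [mul_one, Real.rpow_ofNat, Real.rpow_one]
    push_cast
    ring
  · rw [Complex.ofReal_exp]
    congr 1
    rw [norm_smul, Real.norm_of_nonneg (Real.sqrt_nonneg _),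
      Real.mul_rpow (by positivity) (by positivity), Real.sqrt_eq_rpow,
      ← Real.rpow_mul (by positivity), Real.mul_rpow two_pos.le hs.le]
    push_cast
    ring_nf

theorem lintegral_exp_neg_sq_eq (ht : 0 < t)
    (hμ : ∀ ξ, charFun μ ξ = Complex.exp (-((t * ‖ξ‖ ^ α : ℝ) : ℂ))) {s : ℝ} (hs : 0 < s) :
    ∫⁻ x, ENNReal.ofReal (Real.exp (-(1 * ‖x‖ ^ (2 * (1 : ℝ)) * s ^ (1 : ℝ)))) ∂μ =
      ∫⁻ z, ENNReal.ofReal (Real.exp (-(t * 2 ^ (α / 2) * ‖z‖ ^ (2 * (α / 2)) * s ^ (α / 2))))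
        ∂gaussianDensityMeasure n := by
  rw [← ofReal_integral_eq_lintegral_ofReal, ← ofReal_integral_eq_lintegral_ofReal,
    integral_exp_neg_sq_eq hμ hs]
  · exact integrable_exp_neg_of_nonneg (by fun_prop) fun z ↦ by positivity
  · exact .of_forall fun z ↦ (Real.exp_pos _).le
  · exact integrable_exp_neg_of_nonneg (by fun_prop) fun z ↦ by positivity
  · exact .of_forall fun z ↦ (Real.exp_pos _).le

/-- Both measures have mass 1, so the Laplace identity passes to `1 - exp`, which vanishes at `s =
0` and so tolerates the singular weight `s ^ (-1 - q)`. -/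
theorem lintegral_one_sub_exp_neg_sq_eq (ht : 0 < t)
    (hμ : ∀ ξ, charFun μ ξ = Complex.exp (-((t * ‖ξ‖ ^ α : ℝ) : ℂ))) {s : ℝ} (hs : 0 < s) :
    ∫⁻ x, ENNReal.ofReal (1 - Real.exp (-(1 * ‖x‖ ^ (2 * (1 : ℝ)) * s ^ (1 : ℝ)))) ∂μ =
      ∫⁻ z, ENNReal.ofReal
        (1 - Real.exp (-(t * 2 ^ (α / 2) * ‖z‖ ^ (2 * (α / 2)) * s ^ (α / 2))))
        ∂gaussianDensityMeasure n := by
  have h1 : Integrable (fun x : EuclideanSpace ℝ (Fin n) ↦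
      Real.exp (-(1 * ‖x‖ ^ (2 * (1 : ℝ)) * s ^ (1 : ℝ)))) μ :=
    integrable_exp_neg_of_nonneg (by fun_prop) fun z ↦ by positivity
  have h2 : Integrable (fun z : EuclideanSpace ℝ (Fin n) ↦
      Real.exp (-(t * 2 ^ (α / 2) * ‖z‖ ^ (2 * (α / 2)) * s ^ (α / 2))))
      (gaussianDensityMeasure n) :=
    integrable_exp_neg_of_nonneg (by fun_prop) fun z ↦ by positivity
  rw [← ofReal_integral_eq_lintegral_ofReal (Integrable.sub' (integrable_const 1) h1),
    ← ofReal_integral_eq_lintegral_ofReal (Integrable.sub' (integrable_const 1) h2),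
    integral_sub (integrable_const _) h1, integral_sub (integrable_const _) h2,
    integral_exp_neg_sq_eq hμ hs]
  · simp
  · refine .of_forall fun z ↦ sub_nonneg.2 (Real.exp_le_one_iff.2 (neg_nonpos.2 ?_))
    positivity
  · refine .of_forall fun z ↦ sub_nonneg.2 (Real.exp_le_one_iff.2 (neg_nonpos.2 ?_))
    positivity

/-! ### Moments of the stable law -/

/-- Negative moments of a rotationally symmetric stable law in terms of Gaussian ones. -/
theorem lintegral_norm_rpow_neg_stable (hα0 : 0 < α) (ht : 0 < t)
    (hμ : ∀ ξ, charFun μ ξ = Complex.exp (-((t * ‖ξ‖ ^ α : ℝ) : ℂ))) {p : ℝ} (hp : 0 < p) :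
    ENNReal.ofReal (Real.Gamma p) * ∫⁻ x, ‖x‖ₑ ^ (-(2 * p)) ∂μ =
      ENNReal.ofReal ((t * 2 ^ (α / 2)) ^ (-p / (α / 2)) * (1 / (α / 2)) *
        Real.Gamma (p / (α / 2))) *
        ∫⁻ z, ‖z‖ₑ ^ (-(2 * p)) ∂gaussianDensityMeasure n := by
  have hα : 0 < α / 2 := by positivity
  have ha : 0 < t * 2 ^ (α / 2) := by positivity
  rw [← lintegral_const_mul _ (by fun_prop), ← lintegral_const_mul _ (by fun_prop)]
  simp only [← ofReal_norm]
  simp_rw [← lintegral_Ioi_rpow_mul_exp_norm hp hα ha (norm_nonneg _)]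
  -- The Mellin constant for `β = a = 1`, so that the lemma used on the Gaussian side also applies
  -- to `exp(-s|x|²)`.
  have h1 : ENNReal.ofReal (Real.Gamma p) =
      ENNReal.ofReal (1 ^ (-p / 1) * (1 / 1) * Real.Gamma (p / 1)) := by simp
  rw [h1]
  simp_rw [← lintegral_Ioi_rpow_mul_exp_norm hp one_pos one_pos (norm_nonneg _)]
  refine (lintegral_lintegral_swap (by fun_prop)).trans
    (Eq.trans ?_ (lintegral_lintegral_swap (by fun_prop)).symm)
  refine setLIntegral_congr_fun measurableSet_Ioi fun s (hs : 0 < s) ↦ ?_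
  have hsp : 0 ≤ s ^ (p - 1) := by positivity
  simp_rw [ENNReal.ofReal_mul hsp]
  rw [lintegral_const_mul' _ _ ENNReal.ofReal_ne_top,
    lintegral_const_mul' _ _ ENNReal.ofReal_ne_top, lintegral_exp_neg_sq_eq ht hμ hs]

/-- The `s`-integral is left unevaluated so that the identity serves both `q < α / 2`, where it is
finite, and `q = α / 2`, where it diverges. -/
theorem lintegral_norm_rpow_stable_eq_lintegral (ht : 0 < t)
    (hμ : ∀ ξ, charFun μ ξ = Complex.exp (-((t * ‖ξ‖ ^ α : ℝ) : ℂ))) {q : ℝ} (hq : 0 < q)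
    (hq1 : q < 1) :
    ENNReal.ofReal (Real.Gamma (1 - q) / q) * ∫⁻ x, ‖x‖ₑ ^ (2 * q) ∂μ =
      ∫⁻ z, (∫⁻ s in Set.Ioi (0 : ℝ), ENNReal.ofReal
        ((1 - Real.exp (-(t * 2 ^ (α / 2) * ‖z‖ ^ (2 * (α / 2)) * s ^ (α / 2)))) * s ^ (-1 - q)))
        ∂gaussianDensityMeasure n := by
  rw [← lintegral_const_mul _ (by fun_prop)]
  simp only [← ofReal_norm]
  have h1 : ENNReal.ofReal (Real.Gamma (1 - q) / q) =
      ENNReal.ofReal (1 ^ (q / 1) * Real.Gamma (1 - q / 1) / q) := by simp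
  rw [h1]
  simp_rw [← lintegral_Ioi_one_sub_exp_norm hq hq1 one_pos (norm_nonneg _)]
  refine (lintegral_lintegral_swap (by fun_prop)).trans
    (Eq.trans ?_ (lintegral_lintegral_swap (by fun_prop)).symm)
  refine setLIntegral_congr_fun measurableSet_Ioi fun s (hs : 0 < s) ↦ ?_
  have hsp : 0 ≤ s ^ (-1 - q) := by positivity
  simp_rw [ENNReal.ofReal_mul' hsp]
  rw [lintegral_mul_const' _ _ ENNReal.ofReal_ne_top,
    lintegral_mul_const' _ _ ENNReal.ofReal_ne_top, lintegral_one_sub_exp_neg_sq_eq ht hμ hs]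

theorem ENNReal.eq_ofReal_of_ofReal_mul_eq {a b : ℝ} {x : ℝ≥0∞} (ha : 0 < a)
    (h : ENNReal.ofReal a * x = ENNReal.ofReal b) : x = ENNReal.ofReal (b / a) := by
  rw [ENNReal.ofReal_div_of_pos ha, ← h, mul_comm, ENNReal.mul_div_cancel_right]
  · simpa using ha
  · exact ENNReal.ofReal_ne_top

theorem lintegral_norm_rpow_stable_of_neg (hn : 1 ≤ n) (hα0 : 0 < α) (ht : 0 < t)
    (hμ : ∀ ξ, charFun μ ξ = Complex.exp (-((t * ‖ξ‖ ^ α : ℝ) : ℂ))) {κ : ℝ}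
    (hκn : -(n : ℝ) < κ) (hκ0 : κ < 0) :
    ∫⁻ x, ‖x‖ₑ ^ κ ∂μ = ENNReal.ofReal
      (2 ^ κ * Real.Gamma ((n + κ) / 2) * Real.Gamma (1 - κ / α) /
        (Real.Gamma (n / 2) * Real.Gamma (1 - κ / 2)) * t ^ (κ / α)) := by
  have hp : 0 < -κ / 2 := by linarith
  have hn0 : (0 : ℝ) < n := by exact_mod_cast hn
  have hG := Real.Gamma_pos_of_pos hp
  have hG2 : 0 < Real.Gamma (n / 2) := Real.Gamma_pos_of_pos (by positivity)
  have hpa : 0 < -κ / 2 / (α / 2) := by positivity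
  have hG3 := Real.Gamma_pos_of_pos hpa
  have h := lintegral_norm_rpow_neg_stable hα0 ht hμ hp
  rw [show -(2 * (-κ / 2)) = κ by ring, lintegral_norm_rpow_gaussianDensityMeasure hn hκn,
    ← ENNReal.ofReal_mul (by positivity)] at h
  rw [ENNReal.eq_ofReal_of_ofReal_mul_eq hG h]
  congr 1
  -- `Γ(x + 1) = x Γ(x)` brings the Mellin constants to the form valid for both signs of `κ`.
  have e1 : Real.Gamma (1 - κ / 2) = (-κ / 2) * Real.Gamma (-κ / 2) := by
    rw [← Real.Gamma_add_one hp.ne']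
    ring_nf
  have e2 : Real.Gamma (1 - κ / α) = (-κ / 2 / (α / 2)) * Real.Gamma (-κ / 2 / (α / 2)) := by
    rw [← Real.Gamma_add_one hpa.ne']
    congr 1
    field_simp
    ring
  have e3 : (t * 2 ^ (α / 2)) ^ (-(-κ / 2) / (α / 2)) = t ^ (κ / α) * 2 ^ (κ / 2) := by
    rw [Real.mul_rpow ht.le (by positivity), ← Real.rpow_mul two_pos.le]
    congr 2 <;> field_simp
  have e4 : (2 : ℝ) ^ κ = 2 ^ (κ / 2) * 2 ^ (κ / 2) := by
    rw [← Real.rpow_add two_pos, add_halves]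
  rw [e1, e2, e3, e4]
  have := hκ0.ne
  field_simp

theorem lintegral_norm_rpow_stable_of_pos (hn : 1 ≤ n) (hα0 : 0 < α) (hα2 : α < 2) (ht : 0 < t)
    (hμ : ∀ ξ, charFun μ ξ = Complex.exp (-((t * ‖ξ‖ ^ α : ℝ) : ℂ))) {κ : ℝ}
    (hκ0 : 0 < κ) (hκα : κ < α) :
    ∫⁻ x, ‖x‖ₑ ^ κ ∂μ = ENNReal.ofReal
      (2 ^ κ * Real.Gamma ((n + κ) / 2) * Real.Gamma (1 - κ / α) /
        (Real.Gamma (n / 2) * Real.Gamma (1 - κ / 2)) * t ^ (κ / α)) := by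
  have hq : 0 < κ / 2 := by linarith
  have hn0 : (0 : ℝ) < n := by exact_mod_cast hn
  have hG : 0 < Real.Gamma (1 - κ / 2) := Real.Gamma_pos_of_pos (by linarith)
  have hG2 : 0 < Real.Gamma (n / 2) := Real.Gamma_pos_of_pos (by positivity)
  have hκα' : κ / 2 / (α / 2) = κ / α := by field_simp
  have hG3 : 0 < Real.Gamma (1 - κ / α) :=
    Real.Gamma_pos_of_pos (by rw [sub_pos, div_lt_one hα0]; exact hκα)
  have h := lintegral_norm_rpow_stable_eq_lintegral ht hμ hq (by linarith)
  have hβ : κ / 2 < α / 2 := by linarith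
  have ha : 0 < t * 2 ^ (α / 2) := by positivity
  simp_rw [lintegral_Ioi_one_sub_exp_norm hq hβ ha (norm_nonneg _)] at h
  rw [lintegral_const_mul' _ _ ENNReal.ofReal_ne_top] at h
  simp only [ofReal_norm] at h
  rw [mul_div_cancel₀ κ two_ne_zero, hκα',
    lintegral_norm_rpow_gaussianDensityMeasure hn (by linarith),
    ← ENNReal.ofReal_mul (by positivity)] at h
  rw [ENNReal.eq_ofReal_of_ofReal_mul_eq (by positivity) h]
  congr 1
  have e3 : (t * 2 ^ (α / 2)) ^ (κ / α) = t ^ (κ / α) * 2 ^ (κ / 2) := by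
    rw [Real.mul_rpow ht.le (by positivity), ← Real.rpow_mul two_pos.le]
    congr 2
    field_simp
  have e4 : (2 : ℝ) ^ κ = 2 ^ (κ / 2) * 2 ^ (κ / 2) := by
    rw [← Real.rpow_add two_pos, add_halves]
  rw [e3, e4]
  field_simp

/-! ### Infinite moments -/

theorem lintegral_norm_rpow_stable_eq_top_of_le_neg (hn : 1 ≤ n) (hα0 : 0 < α) (ht : 0 < t)
    (hμ : ∀ ξ, charFun μ ξ = Complex.exp (-((t * ‖ξ‖ ^ α : ℝ) : ℂ))) {κ : ℝ}
    (hκn : κ ≤ -(n : ℝ)) :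
    ∫⁻ x, ‖x‖ₑ ^ κ ∂μ = ⊤ := by
  have hn0 : (0 : ℝ) < n := by exact_mod_cast hn
  have hp : 0 < -κ / 2 := by linarith
  have hG3 := Real.Gamma_pos_of_pos (show 0 < -κ / 2 / (α / 2) by positivity)
  have h := lintegral_norm_rpow_neg_stable hα0 ht hμ hp
  rw [show -(2 * (-κ / 2)) = κ by ring, lintegral_norm_rpow_gaussianDensityMeasure_eq_top hn hκn,
    ENNReal.mul_top] at h
  · by_contra hne
    -- The factor `Γ(-κ/2)` is finite, so the moment itself carries the infinity.
    exact ENNReal.mul_ne_top ENNReal.ofReal_ne_top hne h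
  · rw [ENNReal.ofReal_ne_zero_iff]
    positivity

theorem lintegral_norm_rpow_stable_eq_top (hn : 1 ≤ n) (hα0 : 0 < α) (hα2 : α < 2) (ht : 0 < t)
    (hμ : ∀ ξ, charFun μ ξ = Complex.exp (-((t * ‖ξ‖ ^ α : ℝ) : ℂ))) :
    ∫⁻ x, ‖x‖ₑ ^ α ∂μ = ⊤ := by
  have h := lintegral_norm_rpow_stable_eq_lintegral ht hμ (half_pos hα0) (by linarith)
  rw [mul_div_cancel₀ α two_ne_zero] at h
  have htop : ∀ᵐ z ∂gaussianDensityMeasure n, ∫⁻ s in Set.Ioi (0 : ℝ), ENNReal.ofReal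
      ((1 - Real.exp (-(t * 2 ^ (α / 2) * ‖z‖ ^ α * s ^ (α / 2)))) * s ^ (-1 - α / 2)) = ⊤ := by
    filter_upwards [ae_ne_zero_gaussianDensityMeasure hn] with z hz
    have : 0 < ‖z‖ := norm_pos_iff.2 hz
    exact lintegral_Ioi_one_sub_exp_eq_top (half_pos hα0) (half_pos hα0) le_rfl (by positivity)
  rw [lintegral_congr_ae htop, lintegral_const, measure_univ, mul_one] at h
  by_contra hne
  exact ENNReal.mul_ne_top ENNReal.ofReal_ne_top hne h

/-- Reduces to the exponent `α` through `|x|^α ≤ 1 + |x|^κ`; the constant 1 has finite integral. -/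
theorem lintegral_norm_rpow_stable_eq_top_of_le (hn : 1 ≤ n) (hα0 : 0 < α) (hα2 : α < 2)
    (ht : 0 < t) (hμ : ∀ ξ, charFun μ ξ = Complex.exp (-((t * ‖ξ‖ ^ α : ℝ) : ℂ))) {κ : ℝ}
    (hκα : α ≤ κ) :
    ∫⁻ x, ‖x‖ₑ ^ κ ∂μ = ⊤ := by
  have h : ∫⁻ x, ‖x‖ₑ ^ α ∂μ ≤ ∫⁻ x, (1 + ‖x‖ₑ ^ κ) ∂μ := by
    refine lintegral_mono fun x ↦ ?_
    rcases le_total ‖x‖ₑ 1 with hx | hx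
    · exact (ENNReal.rpow_le_one hx hα0.le).trans le_self_add
    · exact (ENNReal.rpow_le_rpow_of_exponent_le hx hκα).trans le_add_self
  rw [lintegral_norm_rpow_stable_eq_top hn hα0 hα2 ht hμ, lintegral_add_left measurable_const,
    lintegral_const, measure_univ, top_le_iff] at h
  simpa using h

end

theorem mainTheorem6 {Ω : Type*} [MeasurableSpace Ω] (P : Measure Ω) [IsProbabilityMeasure P]
    (n : ℕ) (hn : 1 ≤ n) (α : ℝ) (hα0 : 0 < α) (hα2 : α < 2)
    (X : ℝ≥0 → Ω → EuclideanSpace ℝ (Fin n)) (hX : IsRotSymmStableLevyProcess α X P)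
    (t : ℝ≥0) (ht : 0 < t) (κ : ℝ) :
    (-(n : ℝ) < κ → κ < α →
      ∫⁻ ω, ‖X t ω‖ₑ ^ κ ∂P =
        ENNReal.ofReal
          (2 ^ κ * Real.Gamma (((n : ℝ) + κ) / 2) * Real.Gamma (1 - κ / α) /
            (Real.Gamma ((n : ℝ) / 2) * Real.Gamma (1 - κ / 2)) * (t : ℝ) ^ (κ / α))) ∧
    (κ ≤ -(n : ℝ) ∨ α ≤ κ → ∫⁻ ω, ‖X t ω‖ₑ ^ κ ∂P = ⊤) := by
  have hXm := hX.isLevyProcess.aemeasurable t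
  have hμ := hX.charFun_eq t
  have : IsProbabilityMeasure (P.map (X t)) := Measure.isProbabilityMeasure_map hXm
  have ht' : (0 : ℝ) < t := by exact_mod_cast ht
  have hmap : ∫⁻ ω, ‖X t ω‖ₑ ^ κ ∂P = ∫⁻ x, ‖x‖ₑ ^ κ ∂(P.map (X t)) := by
    rw [lintegral_map' (by fun_prop) hXm]
  rw [hmap]
  refine ⟨fun hκn hκα ↦ ?_, fun h ↦ ?_⟩
  · rcases lt_trichotomy κ 0 with hκ | rfl | hκ
    · exact lintegral_norm_rpow_stable_of_neg hn hα0 ht' hμ hκn hκ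
    -- For `κ = 0` both sides equal 1; the Mellin identities need a nonzero exponent.
    · have hn0 : (0 : ℝ) < n := by exact_mod_cast hn
      have : Real.Gamma (n / 2) ≠ 0 := (Real.Gamma_pos_of_pos (by positivity)).ne'
      simp [this]
    · exact lintegral_norm_rpow_stable_of_pos hn hα0 hα2 ht' hμ hκ hκα
  · rcases h with h | h
    · exact lintegral_norm_rpow_stable_eq_top_of_le_neg hn hα0 ht' hμ h
    · exact lintegral_norm_rpow_stable_eq_top_of_le hn hα0 hα2 ht' hμ h
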